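/- Let $(E,d_E)$ be a complete separable metric space with its Borel $\sigma$-algebra, and suppose that $\sup_{x,y\in E} d_E(x,y)\le D<\infty$. Let $\mu,\tilde\mu$ be Borel probability measures on $E$ and let $\Phi\colon E\to[0,\infty)$ be such that $e^{-\Phi}$ is Lipschitz, i.e. $\mathrm{Lip}(e^{-\Phi})<\infty$, where $\mathrm{Lip}(f):=\sup_{x\ne y}\frac{|f(x)-f(y)|}{d_E(x,y)}$. Put $$Z:=\int_E e^{-\Phi}\,d\mu,\qquad \tilde Z:=\int_E e^{-\Phi}\,d\tilde\mu,\qquad \mu_\Phi(dx):=\frac{1}{Z}e^{-\Phi(x)}\,\mu(dx),\qquad \tilde\mu_\Phi(dx):=\frac{1}{\tilde Z}e^{-\Phi(x)}\,\tilde\mu(dx),$$ $$|\mu|_{\mathcal P^1}:=\inf_{x_0\in E}\int_E d_E(x,x_0)\,\mu(dx),\qquad W_1(\nu_1,\nu_2):=\inf_{\pi}\int_{E\times E} d_E(x,y)\,\pi(dx\,dy),$$ the last infimum being over all couplings $\pi$ of $\nu_1$ and $\nu_2$, i.e. probability measures on $E\times E$ with first marginal $\nu_1$ and second marginal $\nu_2$.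 Then $Z,\tilde Z>0$, $\mu_\Phi$ and $\tilde\mu_\Phi$ are probability measures, $|\mu|_{\mathcal P^1}$, $W_1(\mu,\tilde\mu)$ and $W_1(\mu_\Phi,\tilde\mu_\Phi)$ are finite, and $$W_1(\mu_\Phi,\tilde\mu_\Phi)\;\le\;\frac{1+D\,\mathrm{Lip}(e^{-\Phi})}{\tilde Z}\left(1+\mathrm{Lip}(e^{-\Phi})\,\frac{|\mu|_{\mathcal P^1}}{Z}\right)W_1(\mu,\tilde\mu)$$ and $$|Z-\tilde Z|\;\le\;\mathrm{Lip}(e^{-\Phi})\,W_1(\mu,\tilde\mu).$$ -/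

import Mathlib

open MeasureTheory
open scoped ENNReal

noncomputable section

namespace BayesStability

/-- The evidence `Z = ∫ exp (-Φ) dμ` of a prior `μ` and a negative log-likelihood `Φ`. -/
def evidence {E : Type*} [MeasurableSpace E] (μ : Measure E) (Φ : E → ℝ) : ℝ :=
  ∫ x, Real.exp (-Φ x) ∂μ

/-- The posterior `μ_Φ(dx) = Z⁻¹ exp (-Φ x) μ(dx)`, with `Z = evidence μ Φ`. -/
def posterior {E : Type*} [MeasurableSpace E] (μ : Measure E) (Φ : E → ℝ) : Measure E :=
  μ.withDensity fun x => ENNReal.ofReal (Real.exp (-Φ x) / evidence μ Φ)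

/-- The global Lipschitz constant `sup_{x ≠ y} |f x - f y| / d(x, y)`, with values in `[0, ∞]`. -/
def lipConst {E : Type*} [MetricSpace E] (f : E → ℝ) : ℝ≥0∞ :=
  ⨆ (x : E) (y : E) (_ : x ≠ y), ENNReal.ofReal (|f x - f y| / dist x y)

/-- `|μ|_{P^q} = inf_{x₀} (∫ d(x, x₀)^q μ(dx))^{1/q}`, with values in `[0, ∞]`. -/
def moment {E : Type*} [MetricSpace E] [MeasurableSpace E] (q : ℝ) (μ : Measure E) : ℝ≥0∞ :=
  ⨅ x₀ : E, (∫⁻ x, edist x x₀ ^ q ∂μ) ^ (1 / q)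

/-- The couplings of `μ` and `ν`: probability measures on `E × E` with marginals `μ` and `ν`. -/
def couplings {E : Type*} [MeasurableSpace E] (μ ν : Measure E) : Set (Measure (E × E)) :=
  {π | IsProbabilityMeasure π ∧ π.map Prod.fst = μ ∧ π.map Prod.snd = ν}

/-- The `q`-Wasserstein distance, the infimum over all couplings of the transport cost, with
values in `[0, ∞]`. -/
def wasserstein {E : Type*} [MetricSpace E] [MeasurableSpace E] (q : ℝ) (μ ν : Measure E) :
    ℝ≥0∞ :=
  ⨅ π ∈ couplings μ ν, (∫⁻ p, edist p.1 p.2 ^ q ∂π) ^ (1 / q)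

end BayesStability

end

/-!
The proof works directly with couplings and avoids Kantorovich–Rubinstein duality. Write
`f = exp (-Φ)` and let `π` be a coupling of `μ` and `ν`. The two posteriors are the marginals of
the measures with densities `α (x, y) = f x / Z` and `β (x, y) = f y / Z'` with respect to `π`.
They are coupled by leaving the common part `min α β` where `π` puts it, and by coupling
the first marginal of `(α - β)⁺ π` with the second marginal of `(β - α)⁺ π` by a normalised
product measure, all of whose transport is routed through a base point `x₀`. Since
`d(y, x₀) ≤ d(x, x₀) + d(x, y)` and `min α β + (β - α)⁺ = β`, the cost is at most
`∫ d(x, y) β + d(x, x₀) |α - β| dπ` (`exists_coupling_withDensity`).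

Because `|α - β| ≤ |f x - f y| / Z' + f x |Z - Z'| / (Z Z')`, and
`|Z - Z'| ≤ Lip f * ∫ d(x, y) dπ`, this is at most
`((1 + D Lip f) / Z' + Lip f / (Z Z') * ∫ d(x, x₀) dμ) * ∫ d(x, y) dπ`
(`wasserstein_posterior_le_of_coupling`). The stability estimate follows by taking the infimum
over `x₀` and `π`.
-/

namespace BayesStability

/-! ### Lipschitz constant, moment and Wasserstein distance -/

lemma abs_sub_le_lipConst_mul_dist {E : Type*} [MetricSpace E] {f : E → ℝ}
    (hf : lipConst f < ∞) (x y : E) :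
    |f x - f y| ≤ (lipConst f).toReal * dist x y := by
  rcases eq_or_ne x y with rfl | hxy
  · simp
  have h : ENNReal.ofReal (|f x - f y| / dist x y) ≤ lipConst f :=
    le_iSup_of_le x (le_iSup_of_le y (le_iSup_of_le hxy le_rfl))
  rwa [ENNReal.ofReal_le_iff_le_toReal hf.ne, div_le_iff₀ (dist_pos.2 hxy)] at h

lemma continuous_of_lipConst_lt_top {E : Type*} [MetricSpace E] {f : E → ℝ}
    (hf : lipConst f < ∞) : Continuous f :=
  (LipschitzWith.of_dist_le_mul (K := (lipConst f).toNNReal) fun x y => by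
    rw [Real.dist_eq]
    exact abs_sub_le_lipConst_mul_dist hf x y).continuous

lemma moment_one {E : Type*} [MetricSpace E] [MeasurableSpace E] (μ : Measure E) :
    moment 1 μ = ⨅ x₀ : E, ∫⁻ x, edist x x₀ ∂μ := by
  simp [moment]

lemma wasserstein_one {E : Type*} [MetricSpace E] [MeasurableSpace E] (μ ν : Measure E) :
    wasserstein 1 μ ν = ⨅ π : couplings μ ν, ∫⁻ p, edist p.1 p.2 ∂(π : Measure (E × E)) := by
  simp [wasserstein, iInf_subtype]

lemma edist_le_of_dist_le {E : Type*} [MetricSpace E] {D : ℝ} (hD : ∀ x y : E, dist x y ≤ D)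
    (x y : E) : edist x y ≤ ENNReal.ofReal D := by
  rw [edist_dist]
  exact ENNReal.ofReal_le_ofReal (hD x y)

lemma lintegral_edist_lt_top {E X : Type*} [MetricSpace E] [MeasurableSpace X] {D : ℝ}
    (hD : ∀ x y : E, dist x y ≤ D) (π : Measure X) [IsFiniteMeasure π] (g h : X → E) :
    ∫⁻ p, edist (g p) (h p) ∂π < ∞ :=
  (lintegral_mono fun p => edist_le_of_dist_le hD (g p) (h p)).trans_lt <| by
    rw [lintegral_const]
    exact ENNReal.mul_lt_top ENNReal.ofReal_lt_top (measure_lt_top _ _)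

lemma prod_mem_couplings {E : Type*} [MeasurableSpace E] (μ ν : Measure E)
    [IsProbabilityMeasure μ] [IsProbabilityMeasure ν] : μ.prod ν ∈ couplings μ ν :=
  ⟨inferInstance, by simp, by simp⟩

lemma moment_one_lt_top {E : Type*} [MetricSpace E] [MeasurableSpace E] {D : ℝ}
    (hD : ∀ x y : E, dist x y ≤ D) (μ : Measure E) [IsProbabilityMeasure μ] :
    moment 1 μ < ∞ := by
  obtain ⟨x₀⟩ := μ.nonempty_of_neZero
  rw [moment_one]
  exact (iInf_le _ x₀).trans_lt (lintegral_edist_lt_top hD μ _ _)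

lemma wasserstein_one_lt_top {E : Type*} [MetricSpace E] [MeasurableSpace E] {D : ℝ}
    (hD : ∀ x y : E, dist x y ≤ D) (μ ν : Measure E) [IsProbabilityMeasure μ]
    [IsProbabilityMeasure ν] : wasserstein 1 μ ν < ∞ := by
  rw [wasserstein_one]
  exact (iInf_le _ ⟨μ.prod ν, prod_mem_couplings μ ν⟩).trans_lt
    (lintegral_edist_lt_top hD _ _ _)

/-! ### Evidence and posterior -/

lemma integrable_exp_neg {E : Type*} [MeasurableSpace E] {μ : Measure E}
    [IsFiniteMeasure μ] {Φ : E → ℝ} (hΦ : ∀ x, 0 ≤ Φ x)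
    (hm : Measurable fun x => Real.exp (-Φ x)) :
    Integrable (fun x => Real.exp (-Φ x)) μ :=
  Integrable.of_bound hm.aestronglyMeasurable 1 <| Filter.Eventually.of_forall fun x => by
    simpa [Real.norm_eq_abs, Real.abs_exp] using hΦ x

lemma evidence_pos {E : Type*} [MeasurableSpace E] {μ : Measure E}
    [IsProbabilityMeasure μ] {Φ : E → ℝ}
    (hi : Integrable (fun x => Real.exp (-Φ x)) μ) : 0 < evidence μ Φ :=
  integral_exp_pos hi

lemma isProbabilityMeasure_posterior {E : Type*} [MeasurableSpace E] {μ : Measure E}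
    [IsProbabilityMeasure μ] {Φ : E → ℝ}
    (hi : Integrable (fun x => Real.exp (-Φ x)) μ) :
    IsProbabilityMeasure (posterior μ Φ) := by
  have hZ := evidence_pos hi
  refine ⟨?_⟩
  rw [posterior, withDensity_apply _ .univ, Measure.restrict_univ, ← ofReal_integral_eq_lintegral_ofReal (hi.div_const _)
    (Filter.Eventually.of_forall fun x => by positivity), integral_div]
  change ENNReal.ofReal (evidence μ Φ / evidence μ Φ) = 1
  rw [div_self hZ.ne', ENNReal.ofReal_one]

lemma abs_evidence_sub_le_of_coupling {E : Type*} [MetricSpace E]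
    [SecondCountableTopology E] [MeasurableSpace E] [BorelSpace E]
    {μ ν : Measure E} {π : Measure (E × E)} (hπ : π ∈ couplings μ ν)
    {Φ : E → ℝ} (hΦ : ∀ x, 0 ≤ Φ x)
    (hLip : lipConst (fun x => Real.exp (-Φ x)) < ∞)
    (hfin : ∫⁻ p, edist p.1 p.2 ∂π ≠ ∞) :
    |evidence μ Φ - evidence ν Φ| ≤
      (lipConst fun x => Real.exp (-Φ x)).toReal * (∫⁻ p, edist p.1 p.2 ∂π).toReal := by
  obtain ⟨hp, rfl, rfl⟩ := hπ
  have hm : Measurable fun x => Real.exp (-Φ x) := (continuous_of_lipConst_lt_top hLip).measurable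
  have h₁ : Integrable (fun p : E × E => Real.exp (-Φ p.1)) π :=
    integrable_exp_neg (Φ := fun p : E × E => Φ p.1) (fun p => hΦ p.1) (hm.comp measurable_fst)
  have h₂ : Integrable (fun p : E × E => Real.exp (-Φ p.2)) π :=
    integrable_exp_neg (Φ := fun p : E × E => Φ p.2) (fun p => hΦ p.2) (hm.comp measurable_snd)
  have hd : (∫⁻ p, edist p.1 p.2 ∂π).toReal = ∫ p, dist p.1 p.2 ∂π := by
    rw [integral_eq_lintegral_of_nonneg_ae (Filter.Eventually.of_forall fun p => dist_nonneg)
      (by fun_prop)]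
    simp only [edist_dist]
  have hdi : Integrable (fun p : E × E => dist p.1 p.2) π := by
    refine ⟨by fun_prop, ?_⟩
    rw [hasFiniteIntegral_iff_ofReal (Filter.Eventually.of_forall fun p => dist_nonneg)]
    simpa only [edist_dist] using hfin.lt_top
  unfold evidence
  rw [integral_map measurable_fst.aemeasurable hm.aestronglyMeasurable,
    integral_map measurable_snd.aemeasurable hm.aestronglyMeasurable, ← integral_sub h₁ h₂, hd,
    ← integral_const_mul]
  exact (abs_integral_le_integral_abs).trans <|
    integral_mono (h₁.sub h₂).abs (hdi.const_mul _) fun p =>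
      abs_sub_le_lipConst_mul_dist hLip p.1 p.2

/-! ### Coupling of reweighted marginals -/

lemma map_withDensity_comp {X Y : Type*} [MeasurableSpace X] [MeasurableSpace Y]
    (π : Measure X) {T : X → Y} (hT : Measurable T) {g : Y → ℝ≥0∞} (hg : Measurable g) :
    (π.withDensity fun p => g (T p)).map T = (π.map T).withDensity g := by
  ext s hs
  rw [Measure.map_apply hT hs, withDensity_apply _ (hT hs), withDensity_apply _ hs,
    setLIntegral_map hs hg hT]

/-- Two finite measures of equal mass are the marginals of their normalised product, whose
transport cost is at most the cost of moving all mass to `x₀` and out again. -/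
lemma exists_coupling_of_measure_univ_eq {E : Type*} [MetricSpace E]
    [SecondCountableTopology E] [MeasurableSpace E] [BorelSpace E]
    (ρ₁ ρ₂ : Measure E) [IsFiniteMeasure ρ₁] [IsFiniteMeasure ρ₂]
    (h : ρ₁ Set.univ = ρ₂ Set.univ) (x₀ : E) :
    ∃ γ : Measure (E × E), γ.map Prod.fst = ρ₁ ∧ γ.map Prod.snd = ρ₂ ∧
      ∫⁻ p, edist p.1 p.2 ∂γ ≤ ∫⁻ x, edist x x₀ ∂ρ₁ + ∫⁻ x, edist x x₀ ∂ρ₂ := by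
  obtain ⟨γ, h₁, h₂⟩ : ∃ γ : Measure (E × E), γ.map Prod.fst = ρ₁ ∧ γ.map Prod.snd = ρ₂ := by
    rcases eq_or_ne (ρ₁ Set.univ) 0 with h0 | h0
    · refine ⟨0, ?_, ?_⟩
      · rw [Measure.measure_univ_eq_zero.1 h0, Measure.map_zero]
      · rw [Measure.measure_univ_eq_zero.1 (h.symm.trans h0), Measure.map_zero]
    · refine ⟨(ρ₁ Set.univ)⁻¹ • ρ₁.prod ρ₂, ?_, ?_⟩
      · rw [Measure.map_smul, Measure.map_fst_prod, ← h, smul_smul,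
          ENNReal.inv_mul_cancel h0 (measure_ne_top _ _), one_smul]
      · rw [Measure.map_smul, Measure.map_snd_prod, smul_smul,
          ENNReal.inv_mul_cancel h0 (measure_ne_top _ _), one_smul]
  refine ⟨γ, h₁, h₂, ?_⟩
  rw [← h₁, ← h₂, lintegral_map (by fun_prop) measurable_fst,
    lintegral_map (by fun_prop) measurable_snd, ← lintegral_add_left (by fun_prop)]
  exact lintegral_mono fun p => edist_triangle_right _ _ _

/-- If the densities `α` and `β` have the same mass under `π`, the first marginal of `α π` and
the second marginal of `β π` are coupled by keeping `min α β` in place and moving the remaining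
mass through `x₀`. Truncated subtraction makes `(α - β) + (β - α)` the absolute difference. -/
lemma exists_coupling_withDensity {E : Type*} [MetricSpace E]
    [SecondCountableTopology E] [MeasurableSpace E] [BorelSpace E]
    (π : Measure (E × E)) {α β : E × E → ℝ≥0∞} (hα : Measurable α) (hβ : Measurable β)
    (hαβ : ∫⁻ p, α p ∂π = ∫⁻ p, β p ∂π) (hfin : ∫⁻ p, α p ∂π ≠ ∞) (x₀ : E) :
    ∃ γ : Measure (E × E), γ.map Prod.fst = (π.withDensity α).map Prod.fst ∧
      γ.map Prod.snd = (π.withDensity β).map Prod.snd ∧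
      ∫⁻ p, edist p.1 p.2 ∂γ ≤ ∫⁻ p, (edist p.1 p.2 * β p +
        edist p.1 x₀ * ((α p - β p) + (β p - α p))) ∂π := by
  set δ : E × E → ℝ≥0∞ := fun p => min (α p) (β p) with hδ
  set a : E × E → ℝ≥0∞ := fun p => α p - β p with ha
  set b : E × E → ℝ≥0∞ := fun p => β p - α p with hb
  have hδm : Measurable δ := hα.min hβ
  have ham : Measurable a := hα.sub hβ
  have hbm : Measurable b := hβ.sub hα
  have hδa : δ + a = α := by
    funext p
    simp only [Pi.add_apply, hδ, ha]
    rw [add_comm, tsub_add_min]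
  have hδb : δ + b = β := by
    funext p
    simp only [Pi.add_apply, hδ, hb]
    rw [add_comm, min_comm, tsub_add_min]
  have hIa : ∫⁻ p, α p ∂π = ∫⁻ p, δ p ∂π + ∫⁻ p, a p ∂π := by
    rw [← lintegral_add_left hδm, ← hδa]; rfl
  have hIb : ∫⁻ p, β p ∂π = ∫⁻ p, δ p ∂π + ∫⁻ p, b p ∂π := by
    rw [← lintegral_add_left hδm, ← hδb]; rfl
  have hfδ : ∫⁻ p, δ p ∂π ≠ ∞ := fun h => hfin (by rw [hIa, h, top_add])
  have hfa : ∫⁻ p, a p ∂π ≠ ∞ := fun h => hfin (by rw [hIa, h, add_top])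
  have hab : ∫⁻ p, a p ∂π = ∫⁻ p, b p ∂π :=
    (ENNReal.add_right_inj hfδ).1 (by rw [← hIa, ← hIb, hαβ])
  have hfina := isFiniteMeasure_withDensity hfa
  have hfinb := isFiniteMeasure_withDensity (hab ▸ hfa)
  obtain ⟨γ, h₁, h₂, hγ⟩ := exists_coupling_of_measure_univ_eq
    ((π.withDensity a).map Prod.fst) ((π.withDensity b).map Prod.snd)
    (by rw [Measure.map_apply measurable_fst .univ, Measure.map_apply measurable_snd .univ,
      Set.preimage_univ, Set.preimage_univ, withDensity_apply _ .univ, withDensity_apply _ .univ,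
      Measure.restrict_univ, hab]) x₀
  refine ⟨π.withDensity δ + γ, ?_, ?_, ?_⟩
  · rw [Measure.map_add _ _ measurable_fst, h₁, ← Measure.map_add _ _ measurable_fst,
      ← withDensity_add_left hδm, hδa]
  · rw [Measure.map_add _ _ measurable_snd, h₂, ← Measure.map_add _ _ measurable_snd,
      ← withDensity_add_left hδm, hδb]
  · rw [lintegral_map (by fun_prop) measurable_fst, lintegral_map (by fun_prop) measurable_snd,
      lintegral_withDensity_eq_lintegral_mul _ ham (by fun_prop),
      lintegral_withDensity_eq_lintegral_mul _ hbm (by fun_prop)] at hγ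
    rw [lintegral_add_measure, lintegral_withDensity_eq_lintegral_mul _ hδm (by fun_prop)]
    refine (add_le_add_right hγ _).trans ?_
    rw [← lintegral_add_left (by fun_prop), ← lintegral_add_left (by fun_prop)]
    refine lintegral_mono fun p => ?_
    simp only [Pi.mul_apply]
    have hβp : δ p + b p = β p := congrFun hδb p
    have htri : edist p.2 x₀ ≤ edist p.1 p.2 + edist p.1 x₀ := by
      rw [edist_comm p.1 p.2]
      exact edist_triangle _ _ _
    calc δ p * edist p.1 p.2 + (a p * edist p.1 x₀ + b p * edist p.2 x₀)
        ≤ δ p * edist p.1 p.2 +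
          (a p * edist p.1 x₀ + b p * (edist p.1 p.2 + edist p.1 x₀)) := by gcongr
      _ = edist p.1 p.2 * β p + edist p.1 x₀ * (a p + b p) := by
        rw [← hβp]; ring

/-! ### Stability of the posterior -/

lemma ofReal_tsub_add_tsub {s t : ℝ} (hs : 0 ≤ s) (ht : 0 ≤ t) :
    (ENNReal.ofReal s - ENNReal.ofReal t) + (ENNReal.ofReal t - ENNReal.ofReal s) =
      ENNReal.ofReal |s - t| := by
  rw [← ENNReal.ofReal_sub _ ht, ← ENNReal.ofReal_sub _ hs]
  rcases le_total s t with h | h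
  · rw [ENNReal.ofReal_of_nonpos (sub_nonpos.2 h), zero_add, abs_of_nonpos (sub_nonpos.2 h),
      neg_sub]
  · rw [ENNReal.ofReal_of_nonpos (sub_nonpos.2 h), add_zero, abs_of_nonneg (sub_nonneg.2 h)]

/-- Pointwise bound for the transport cost: `s`, `t` stand for the values of `exp (-Φ)` at two
points at distance `d`, `e` for the distance to the base point, and `Z`, `Z'` for the
evidences. -/
lemma cost_density_le {s t Z Z' L C D d e : ℝ} (hs : 0 ≤ s) (hs1 : s ≤ 1) (ht1 : t ≤ 1)
    (hZ : 0 < Z) (hZ' : 0 < Z') (hd : 0 ≤ d) (he : 0 ≤ e) (heD : e ≤ D) (hL : 0 ≤ L)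
    (hst : |s - t| ≤ L * d) (hZZ : |Z - Z'| ≤ L * C) :
    d * (t / Z') + e * |s / Z - t / Z'| ≤
      (1 + D * L) / Z' * d + L / (Z * Z') * C * e := by
  have h₁ : |s / Z - t / Z'| ≤ L * d / Z' + L * C / (Z * Z') := by
    have : s / Z - t / Z' = (s - t) / Z' + s * (Z' - Z) / (Z * Z') := by
      field_simp
      ring
    rw [this]
    refine (abs_add_le _ _).trans ?_
    rw [abs_div, abs_div, abs_mul, abs_of_pos hZ', abs_of_pos (mul_pos hZ hZ'),
      abs_of_nonneg hs, abs_sub_comm Z' Z]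
    have hsZ : s * |Z - Z'| ≤ L * C := (mul_le_of_le_one_left (abs_nonneg _) hs1).trans hZZ
    exact add_le_add (div_le_div_of_nonneg_right hst hZ'.le)
      (div_le_div_of_nonneg_right hsZ (mul_pos hZ hZ').le)
  calc d * (t / Z') + e * |s / Z - t / Z'|
      ≤ d * (1 / Z') + e * (L * d / Z' + L * C / (Z * Z')) := by gcongr
    _ = d * (1 / Z') + e * (L * d / Z') + L / (Z * Z') * C * e := by ring
    _ ≤ d * (1 / Z') + D * (L * d / Z') + L / (Z * Z') * C * e := by gcongr
    _ = (1 + D * L) / Z' * d + L / (Z * Z') * C * e := by ring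

lemma wasserstein_posterior_le_of_coupling {E : Type*} [MetricSpace E]
    [SecondCountableTopology E] [MeasurableSpace E] [BorelSpace E]
    {μ ν : Measure E} [IsProbabilityMeasure μ] [IsProbabilityMeasure ν]
    {Φ : E → ℝ} (hΦ : ∀ x, 0 ≤ Φ x)
    {D : ℝ} (hD : ∀ x y : E, dist x y ≤ D)
    (hLip : lipConst (fun x => Real.exp (-Φ x)) < ∞)
    {π : Measure (E × E)} (hπ : π ∈ couplings μ ν) (x₀ : E) :
    wasserstein 1 (posterior μ Φ) (posterior ν Φ) ≤
      (ENNReal.ofReal ((1 + D * (lipConst fun x => Real.exp (-Φ x)).toReal) / evidence ν Φ) +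
        ENNReal.ofReal ((lipConst fun x => Real.exp (-Φ x)).toReal /
          (evidence μ Φ * evidence ν Φ)) * ∫⁻ x, edist x x₀ ∂μ) *
      ∫⁻ p, edist p.1 p.2 ∂π := by
  have hm : Measurable fun x => Real.exp (-Φ x) := (continuous_of_lipConst_lt_top hLip).measurable
  have hiμ : Integrable (fun x => Real.exp (-Φ x)) μ := integrable_exp_neg hΦ hm
  have hiν : Integrable (fun x => Real.exp (-Φ x)) ν := integrable_exp_neg hΦ hm
  have hpμ := isProbabilityMeasure_posterior hiμ
  have hpν := isProbabilityMeasure_posterior hiν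
  have hZ := evidence_pos hiμ
  have hZ' := evidence_pos hiν
  have hπp : IsProbabilityMeasure π := hπ.1
  have hC : ∫⁻ p, edist p.1 p.2 ∂π ≠ ∞ := (lintegral_edist_lt_top hD π Prod.fst Prod.snd).ne
  have hZZ := abs_evidence_sub_le_of_coupling hπ hΦ hLip hC
  have hD0 : 0 ≤ D := dist_nonneg.trans (hD x₀ x₀)
  set L := (lipConst fun x => Real.exp (-Φ x)).toReal
  have hL : 0 ≤ L := ENNReal.toReal_nonneg
  set Z := evidence μ Φ
  set Z' := evidence ν Φ
  set C := (∫⁻ p, edist p.1 p.2 ∂π).toReal with hCdef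
  have hgμ : Measurable fun x => ENNReal.ofReal (Real.exp (-Φ x) / Z) :=
    (hm.div_const _).ennreal_ofReal
  have hgν : Measurable fun x => ENNReal.ofReal (Real.exp (-Φ x) / Z') :=
    (hm.div_const _).ennreal_ofReal
  have hμ : (π.withDensity fun p => ENNReal.ofReal (Real.exp (-Φ p.1) / Z)).map Prod.fst =
      posterior μ Φ := by
    rw [map_withDensity_comp π measurable_fst hgμ, hπ.2.1]
    rfl
  have hν : (π.withDensity fun p => ENNReal.ofReal (Real.exp (-Φ p.2) / Z')).map Prod.snd =
      posterior ν Φ := by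
    rw [map_withDensity_comp π measurable_snd hgν, hπ.2.2]
    rfl
  have hα : ∫⁻ p : E × E, ENNReal.ofReal (Real.exp (-Φ p.1) / Z) ∂π = 1 := by
    have h := congrArg (fun ρ : Measure E => ρ Set.univ) hμ
    simpa [Measure.map_apply measurable_fst MeasurableSet.univ] using h
  have hβ : ∫⁻ p : E × E, ENNReal.ofReal (Real.exp (-Φ p.2) / Z') ∂π = 1 := by
    have h := congrArg (fun ρ : Measure E => ρ Set.univ) hν
    simpa [Measure.map_apply measurable_snd MeasurableSet.univ] using h
  obtain ⟨γ, h₁, h₂, hγ⟩ := exists_coupling_withDensity π (hgμ.comp measurable_fst)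
    (hgν.comp measurable_snd) (hα.trans hβ.symm) (hα.trans_ne ENNReal.one_ne_top) x₀
  have hγc : γ ∈ couplings (posterior μ Φ) (posterior ν Φ) := by
    refine ⟨⟨?_⟩, h₁.trans hμ, h₂.trans hν⟩
    have h := congrArg (fun ρ : Measure E => ρ Set.univ) (h₁.trans hμ)
    simpa [Measure.map_apply measurable_fst MeasurableSet.univ] using h
  rw [wasserstein_one]
  refine (iInf_le _ (⟨γ, hγc⟩ : couplings (posterior μ Φ) (posterior ν Φ))).trans (hγ.trans ?_)
  have hpt : ∀ p : E × E,
      edist p.1 p.2 * ENNReal.ofReal (Real.exp (-Φ p.2) / Z') +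
        edist p.1 x₀ * ((ENNReal.ofReal (Real.exp (-Φ p.1) / Z) -
            ENNReal.ofReal (Real.exp (-Φ p.2) / Z')) +
          (ENNReal.ofReal (Real.exp (-Φ p.2) / Z') - ENNReal.ofReal (Real.exp (-Φ p.1) / Z))) ≤
      ENNReal.ofReal ((1 + D * L) / Z') * edist p.1 p.2 +
        ENNReal.ofReal (L / (Z * Z') * C) * edist p.1 x₀ := fun p => by
    have hC0 : 0 ≤ C := ENNReal.toReal_nonneg
    rw [ofReal_tsub_add_tsub (by positivity) (by positivity), edist_dist, edist_dist,
      ← ENNReal.ofReal_mul dist_nonneg, ← ENNReal.ofReal_mul dist_nonneg,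
      ← ENNReal.ofReal_mul (by positivity), ← ENNReal.ofReal_mul (by positivity),
      ← ENNReal.ofReal_add (by positivity) (by positivity),
      ← ENNReal.ofReal_add (by positivity) (by positivity)]
    exact ENNReal.ofReal_le_ofReal <| cost_density_le (Real.exp_nonneg _)
      (Real.exp_le_one_iff.2 (neg_nonpos.2 (hΦ _))) (Real.exp_le_one_iff.2 (neg_nonpos.2 (hΦ _)))
      hZ hZ' dist_nonneg dist_nonneg (hD _ _) hL
      (abs_sub_le_lipConst_mul_dist hLip _ _) hZZ
  refine (lintegral_mono hpt).trans (le_of_eq ?_)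
  have hmarg : ∫⁻ p, edist p.1 x₀ ∂π = ∫⁻ x, edist x x₀ ∂μ := by
    rw [← hπ.2.1, lintegral_map (by fun_prop) measurable_fst]
  rw [lintegral_add_left (by fun_prop), lintegral_const_mul _ (by fun_prop),
    lintegral_const_mul _ (by fun_prop), hmarg,
    ENNReal.ofReal_mul (by positivity), hCdef, ENNReal.ofReal_toReal hC]
  ring

/-- The estimate is slightly sharper than the product form of the stability theorem: the factor
`1 + D Lip` does not multiply the moment term. -/
lemma wasserstein_posterior_le {E : Type*} [MetricSpace E]
    [SecondCountableTopology E] [MeasurableSpace E] [BorelSpace E]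
    {μ ν : Measure E} [IsProbabilityMeasure μ] [IsProbabilityMeasure ν]
    {Φ : E → ℝ} (hΦ : ∀ x, 0 ≤ Φ x)
    {D : ℝ} (hD : ∀ x y : E, dist x y ≤ D)
    (hLip : lipConst (fun x => Real.exp (-Φ x)) < ∞) :
    wasserstein 1 (posterior μ Φ) (posterior ν Φ) ≤
      (ENNReal.ofReal ((1 + D * (lipConst fun x => Real.exp (-Φ x)).toReal) / evidence ν Φ) +
        ENNReal.ofReal ((lipConst fun x => Real.exp (-Φ x)).toReal /
          (evidence μ Φ * evidence ν Φ)) * moment 1 μ) * wasserstein 1 μ ν := by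
  obtain ⟨x₀⟩ := μ.nonempty_of_neZero
  have hE : Nonempty E := ⟨x₀⟩
  rw [moment_one, wasserstein_one μ ν, ENNReal.mul_iInf fun h => absurd h ENNReal.ofReal_ne_top,
    ENNReal.add_iInf]
  refine ENNReal.le_iInf_mul_iInf ⟨x₀, ?_⟩ ⟨⟨μ.prod ν, prod_mem_couplings μ ν⟩, ?_⟩
    fun x π => wasserstein_posterior_le_of_coupling hΦ hD hLip π.2 x
  · exact ENNReal.add_ne_top.2 ⟨ENNReal.ofReal_ne_top,
      ENNReal.mul_ne_top ENNReal.ofReal_ne_top (lintegral_edist_lt_top hD μ _ _).ne⟩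
  · exact (lintegral_edist_lt_top hD _ _ _).ne

lemma abs_evidence_sub_le {E : Type*} [MetricSpace E]
    [SecondCountableTopology E] [MeasurableSpace E] [BorelSpace E]
    {μ ν : Measure E} [IsProbabilityMeasure μ] [IsProbabilityMeasure ν]
    {Φ : E → ℝ} (hΦ : ∀ x, 0 ≤ Φ x)
    {D : ℝ} (hD : ∀ x y : E, dist x y ≤ D)
    (hLip : lipConst (fun x => Real.exp (-Φ x)) < ∞) :
    |evidence μ Φ - evidence ν Φ| ≤
      (lipConst fun x => Real.exp (-Φ x)).toReal * (wasserstein 1 μ ν).toReal := by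
  have hne : Nonempty (couplings μ ν) := ⟨⟨μ.prod ν, prod_mem_couplings μ ν⟩⟩
  have hfin : ∀ π : couplings μ ν, ∫⁻ p, edist p.1 p.2 ∂(π : Measure (E × E)) ≠ ∞ := fun π => by
    have := π.2.1
    exact (lintegral_edist_lt_top hD (π : Measure (E × E)) Prod.fst Prod.snd).ne
  rw [wasserstein_one, ENNReal.toReal_iInf hfin, Real.mul_iInf_of_nonneg ENNReal.toReal_nonneg]
  exact le_ciInf fun π => abs_evidence_sub_le_of_coupling π.2 hΦ hLip (hfin π)

end BayesStability

theorem mainTheorem1 {E : Type*} [MetricSpace E] [CompleteSpace E]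
    [TopologicalSpace.SeparableSpace E] [MeasurableSpace E] [BorelSpace E]
    (μ ν : Measure E) [IsProbabilityMeasure μ] [IsProbabilityMeasure ν]
    (Φ : E → ℝ) (hΦ : ∀ x, 0 ≤ Φ x)
    (D : ℝ) (hD : ∀ x y : E, dist x y ≤ D)
    (hLip : BayesStability.lipConst (fun x => Real.exp (-Φ x)) < ∞) :
    -- the evidences lie in `(0, ∞)`, and the posteriors are probability measures
    (0 < BayesStability.evidence μ Φ ∧ 0 < BayesStability.evidence ν Φ ∧
      IsProbabilityMeasure (BayesStability.posterior μ Φ) ∧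
      IsProbabilityMeasure (BayesStability.posterior ν Φ)) ∧
    -- the extended real quantities below are finite
    (BayesStability.moment 1 μ < ∞ ∧ BayesStability.wasserstein 1 μ ν < ∞ ∧
      BayesStability.wasserstein 1 (BayesStability.posterior μ Φ)
        (BayesStability.posterior ν Φ) < ∞) ∧
    -- Lipschitz stability of the posterior
    (BayesStability.wasserstein 1 (BayesStability.posterior μ Φ)
        (BayesStability.posterior ν Φ)).toReal ≤
      (1 + D * (BayesStability.lipConst fun x => Real.exp (-Φ x)).toReal) /
          BayesStability.evidence ν Φ *
        (1 + (BayesStability.lipConst fun x => Real.exp (-Φ x)).toReal *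
          ((BayesStability.moment 1 μ).toReal / BayesStability.evidence μ Φ)) *
        (BayesStability.wasserstein 1 μ ν).toReal ∧
    -- Lipschitz stability of the evidence
    |BayesStability.evidence μ Φ - BayesStability.evidence ν Φ| ≤
      (BayesStability.lipConst fun x => Real.exp (-Φ x)).toReal *
        (BayesStability.wasserstein 1 μ ν).toReal := by
  have hsc : SecondCountableTopology E := UniformSpace.secondCountable_of_separable E
  have hm : Measurable fun x => Real.exp (-Φ x) :=
    (BayesStability.continuous_of_lipConst_lt_top hLip).measurable
  have hiμ : Integrable (fun x => Real.exp (-Φ x)) μ := BayesStability.integrable_exp_neg hΦ hm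
  have hiν : Integrable (fun x => Real.exp (-Φ x)) ν := BayesStability.integrable_exp_neg hΦ hm
  have hpμ := BayesStability.isProbabilityMeasure_posterior hiμ
  have hpν := BayesStability.isProbabilityMeasure_posterior hiν
  have hZ := BayesStability.evidence_pos hiμ
  have hZ' := BayesStability.evidence_pos hiν
  have hM := BayesStability.moment_one_lt_top hD μ
  have hW := BayesStability.wasserstein_one_lt_top hD μ ν
  refine ⟨⟨hZ, hZ', hpμ, hpν⟩, ⟨hM, hW, BayesStability.wasserstein_one_lt_top hD _ _⟩, ?_,
    BayesStability.abs_evidence_sub_le hΦ hD hLip⟩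
  have hB := BayesStability.wasserstein_posterior_le (μ := μ) (ν := ν) hΦ hD hLip
  obtain ⟨x₀⟩ := μ.nonempty_of_neZero
  have hD0 : 0 ≤ D := dist_nonneg.trans (hD x₀ x₀)
  set L := (BayesStability.lipConst fun x => Real.exp (-Φ x)).toReal
  have hL : 0 ≤ L := ENNReal.toReal_nonneg
  set Z := BayesStability.evidence μ Φ
  set Z' := BayesStability.evidence ν Φ
  have hBM : ENNReal.ofReal (L / (Z * Z')) * BayesStability.moment 1 μ ≠ ∞ :=
    ENNReal.mul_ne_top ENNReal.ofReal_ne_top hM.ne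
  have hR := ENNReal.toReal_mono
    (ENNReal.mul_ne_top (ENNReal.add_ne_top.2 ⟨ENNReal.ofReal_ne_top, hBM⟩) hW.ne) hB
  rw [ENNReal.toReal_mul, ENNReal.toReal_add ENNReal.ofReal_ne_top hBM, ENNReal.toReal_mul,
    ENNReal.toReal_ofReal (by positivity), ENNReal.toReal_ofReal (by positivity)] at hR
  refine hR.trans (mul_le_mul_of_nonneg_right ?_ ENNReal.toReal_nonneg)
  set M := (BayesStability.moment 1 μ).toReal
  have hM0 : 0 ≤ M := ENNReal.toReal_nonneg
  -- the term by which the product form exceeds the sum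
  have hextra : 0 ≤ D * L * (L * M / (Z * Z')) := by positivity
  calc (1 + D * L) / Z' + L / (Z * Z') * M
      ≤ (1 + D * L) / Z' + L / (Z * Z') * M + D * L * (L * M / (Z * Z')) := by linarith
    _ = (1 + D * L) / Z' * (1 + L * (M / Z)) := by field_simp; ring
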